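/- Let $K$ be a field, let $S=K[x_1,\dots,x_n]$, and let $I\subseteq S$ be a monomial ideal whose minimal monomial generators $f_1,\dots,f_m$ all have the same degree $d$. For $1\le i\le n$ let $M_i$ be the highest exponent with which $x_i$ occurs in $f_1,\dots,f_m$, and let $M=\max_i M_i$ (a maximum over the empty set being $0$). In the polynomial ring $R=K[x_1,\dots,x_n,y_1,\dots,y_m]$, with all variables of degree $1$, consider the ideals $$\mathrm{Lin}(I)=\big(x_1^{a_1}\cdots x_n^{a_n}\mid a_1+\dots+a_n=d,\ a_i\le M_i\text{ for all }i\big)+L,$$ $$\mathrm{LIN}(I)=\big(x_1^{a_1}\cdots x_n^{a_n}\mid a_1+\dots+a_n=d,\ a_i\le M\text{ for all }i\big)+L,$$ where $$L=\Big(\frac{f_j}{x_k}\,y_j\;\Big|\;1\le j\le m,\ 1\le k\le n,\ x_k\text{ divides }f_j\Big).$$ Then both $\mathrm{Lin}(I)$ and $\mathrm{LIN}(I)$ have a $d$-linear resolution over $R$: each of them has a minimal graded free resolution $\cdots\to F_2\to F_1\to F_0\to J\to 0$ (where $J$ is the ideal in question) with $F_i=\bigoplus_{j\in\mathbb Z}R(-j)^{\beta_{i,j}}$,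 all $\beta_{i,j}$ finite, such that $\beta_{i,j}=0$ whenever $j\ne i+d$. -/

import Mathlib

open MvPolynomial

/-- `f` is homogeneous of (integer) degree `z` for the standard grading; if `z < 0` this forces
`f = 0`. -/
def IsHomogeneousOfDegree {σ K : Type*} [CommSemiring K] (f : MvPolynomial σ K) (z : ℤ) : Prop :=
  ∀ m ∈ f.support, (m.degree : ℤ) = z

/-- The homogeneous elements of degree `k` in the graded free module `⨁ b, R(-s b)`. -/
def IsShiftedHomogeneous {σ K B : Type*} [CommSemiring K] (s : B → ℤ)
    (v : B → MvPolynomial σ K) (k : ℤ) : Prop :=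
  ∀ b, IsHomogeneousOfDegree (v b) (k - s b)

/-- A minimal graded free resolution `⋯ → F₂ → F₁ → F₀ → I → 0` of an ideal `I` of the polynomial
ring `R = K[σ]`. The `i`-th module is `F i = ⨁_{b : basis i} R(-shift i b)`, of finite rank. -/
structure MinimalGradedFreeResolution {σ K : Type*} [Field K] (I : Ideal (MvPolynomial σ K)) where
  basis : ℕ → Type
  [fintypeBasis : ∀ i, Fintype (basis i)]
  shift : ∀ i, basis i → ℤ
  /-- `d i` is the differential `F (i + 1) → F i`. -/
  d : ∀ i, (basis (i + 1) → MvPolynomial σ K) →ₗ[MvPolynomial σ K] (basis i → MvPolynomial σ K)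
  /-- The augmentation `F 0 → I`. -/
  ε : (basis 0 → MvPolynomial σ K) →ₗ[MvPolynomial σ K] I
  ε_surjective : Function.Surjective ε
  exact_zero : Function.Exact (d 0) ε
  exact_succ : ∀ i, Function.Exact (d (i + 1)) (d i)
  ε_graded : ∀ v k, IsShiftedHomogeneous (shift 0) v k →
    IsHomogeneousOfDegree (ε v : MvPolynomial σ K) k
  d_graded : ∀ i v k, IsShiftedHomogeneous (shift (i + 1)) v k →
    IsShiftedHomogeneous (shift i) (d i v) k
  minimal : ∀ i, LinearMap.range (d i) ≤
    idealOfVars σ K • (⊤ : Submodule (MvPolynomial σ K) (basis i → MvPolynomial σ K))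

/-- The graded Betti number `β_{i,j}`: the number of summands `R(-j)` in the `i`-th module. -/
noncomputable def MinimalGradedFreeResolution.betti {σ K : Type*} [Field K]
    {I : Ideal (MvPolynomial σ K)} (F : MinimalGradedFreeResolution I) (i : ℕ) (j : ℤ) : ℕ :=
  Nat.card {b : F.basis i // F.shift i b = j}

/-- `I` has a `d`-linear resolution: its minimal graded free resolution satisfies `β_{i,j} = 0`
for all `j ≠ i + d`. -/
def HasLinearResolution {σ K : Type*} [Field K] (I : Ideal (MvPolynomial σ K)) (d : ℕ) : Prop :=
  ∃ F : MinimalGradedFreeResolution I, ∀ (i : ℕ) (j : ℤ), j ≠ i + d → F.betti i j = 0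

/-- An ideal is monomial if it is generated by monomials. -/
def IsMonomialIdeal {σ K : Type*} [Field K] (I : Ideal (MvPolynomial σ K)) : Prop :=
  ∃ s : Set (σ →₀ ℕ), I = Ideal.span ((fun a => monomial a (1 : K)) '' s)

/-- The exponent vectors of the minimal monomial generators `G(I)`: the monomials in `I` that are
minimal with respect to divisibility. -/
def minGens {σ K : Type*} [Field K] (I : Ideal (MvPolynomial σ K)) : Set (σ →₀ ℕ) :=
  {a | Minimal (fun b => monomial b (1 : K) ∈ I) a}

/-- All minimal monomial generators have degree `d`. -/
def IsEquigenerated {σ K : Type*} [Field K] (I : Ideal (MvPolynomial σ K)) (d : ℕ) : Prop :=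
  ∀ f ∈ minGens I, f.degree = d

/-- `M_i`: the highest exponent with which `x_i` occurs in `G(I)` (`0` if `G(I)` is empty). -/
noncomputable def maxExp {n : ℕ} {K : Type*} [Field K] (I : Ideal (MvPolynomial (Fin n) K))
    (i : Fin n) : ℕ :=
  ⨆ f : minGens I, f.1 i

/-- `M`: the highest exponent occurring in `G(I)`. -/
noncomputable def maxExpAll {n : ℕ} {K : Type*} [Field K]
    (I : Ideal (MvPolynomial (Fin n) K)) : ℕ :=
  ⨆ i : Fin n, maxExp I i

/-- The ring `K[x_1, …, x_n, y_1, …, y_m]`, with one variable `y_f` for each `f ∈ G(I)`. -/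
abbrev LinRing {n : ℕ} {K : Type*} [Field K] (I : Ideal (MvPolynomial (Fin n) K)) : Type _ :=
  MvPolynomial (Fin n ⊕ minGens I) K

/-- The ideal generated by the monomials of degree `d` in the `x`-variables in which the exponent
of `x_i` is at most `v i` for all `i`. -/
noncomputable def completePart {n : ℕ} {K : Type*} [Field K] (I : Ideal (MvPolynomial (Fin n) K))
    (d : ℕ) (v : Fin n → ℕ) : Ideal (LinRing I) :=
  Ideal.span {p | ∃ a : Fin n →₀ ℕ, a.degree = d ∧ (∀ i, a i ≤ v i) ∧
    p = rename Sum.inl (monomial a (1 : K))}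

/-- The ideal generated by the monomials `(f / x_k) y_f` with `f ∈ G(I)` and `x_k ∣ f`. -/
noncomputable def lastPart {n : ℕ} {K : Type*} [Field K] (I : Ideal (MvPolynomial (Fin n) K)) :
    Ideal (LinRing I) :=
  Ideal.span {p | ∃ (f : minGens I) (k : Fin n), f.1 k ≠ 0 ∧
    p = rename Sum.inl (monomial (f.1 - Finsupp.single k 1) (1 : K)) * X (Sum.inr f)}

/-- The linearization `Lin(I)` of a monomial ideal `I` equigenerated in degree `d`. -/
noncomputable def Lin {n : ℕ} {K : Type*} [Field K] (I : Ideal (MvPolynomial (Fin n) K))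
    (d : ℕ) : Ideal (LinRing I) :=
  completePart I d (maxExp I) ⊔ lastPart I

/-- The `*`-linearization `LIN(I)` of a monomial ideal `I` equigenerated in degree `d`. -/
noncomputable def LINStar {n : ℕ} {K : Type*} [Field K] (I : Ideal (MvPolynomial (Fin n) K))
    (d : ℕ) : Ideal (LinRing I) :=
  completePart I d (fun _ => maxExpAll I) ⊔ lastPart I

/-!
The ideal has linear quotients: ordering its monomial generators by the lexicographic order of
their `x`-parts, largest first, each colon ideal `(u₁, …, u_{b-1}) : u_b` is generated by variables.
If `u_b = x^b` and the `x`-part `a` of an earlier generator first exceeds `b` at `i`, then `a` is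
smaller than `b` at some `j > i`, and the earlier generator `x_i x^b / x_j` divides `x_i u_b`. If
`u_b = (f / x_k) y_f`, then a generator whose `x`-part is not `f / x_k` has a larger exponent than
`u_b` at some `x_i`, and the earlier generator `x_i f / x_k` divides `x_i u_b`; a generator with the
same `x`-part is `(f / x_k) y_g` and divides `y_g u_b`.

Linear quotients give a linear resolution. Each variable `z` in the colon ideal of `u_b` contributes
a linear syzygy with leading term `z` at position `b`, and these syzygies generate all syzygies. If
the pairs `(b, z)` are ordered lexicographically, the linear syzygies have linear quotients
themselves, the colon ideal of `(b, z)` being generated by the variables `y < z` of `b`. So the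
construction can be iterated, and every differential after the augmentation is a matrix of linear
forms.
-/

section Grading

theorem homogeneousComponent_mul_of_isHomogeneous {σ K : Type*} [CommSemiring K]
    {q : MvPolynomial σ K} {e : ℕ} (hq : q.IsHomogeneous e) (k : ℕ) (p : MvPolynomial σ K) :
    homogeneousComponent (k + e) (p * q) = homogeneousComponent k p * q := by
  let _ := gradedAlgebra (σ := σ) (R := K)
  have h := DirectSum.coe_decompose_mul_add_of_right_mem (homogeneousSubmodule σ K) (i := k)
    (a := p) ((mem_homogeneousSubmodule e q).2 hq)
  simpa only [DirectSum.decompose, Equiv.coe_fn_mk, decomposition.decompose'_apply] using h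

variable {σ K : Type*} [CommSemiring K]

theorem mem_pow_idealOfVars_of_isHomogeneous {p : MvPolynomial σ K} {e : ℕ}
    (hp : p.IsHomogeneous e) : p ∈ idealOfVars σ K ^ e := by
  rw [mem_pow_idealOfVars_iff]
  intro m hm
  rw [Finsupp.degree_eq_weight_one]
  exact (hp (mem_support_iff.1 hm)).ge

theorem isHomogeneousOfDegree_natCast {p : MvPolynomial σ K} {e : ℕ} :
    IsHomogeneousOfDegree p e ↔ p.IsHomogeneous e := by
  simp only [IsHomogeneousOfDegree, IsHomogeneous, IsWeightedHomogeneous, mem_support_iff,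
    Finsupp.degree_eq_weight_one, Nat.cast_inj]
  rfl

theorem IsHomogeneousOfDegree.sum {ι : Type*} {z : ℤ} {s : Finset ι} {p : ι → MvPolynomial σ K}
    (hp : ∀ i ∈ s, IsHomogeneousOfDegree (p i) z) : IsHomogeneousOfDegree (∑ i ∈ s, p i) z :=
  sum_mem (S := restrictSupport K {m | (m.degree : ℤ) = z}) hp

theorem IsHomogeneousOfDegree.mul {p q : MvPolynomial σ K} {y z : ℤ}
    (hp : IsHomogeneousOfDegree p y) (hq : IsHomogeneousOfDegree q z) :
    IsHomogeneousOfDegree (p * q) (y + z) := by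
  classical
  intro m hm
  obtain ⟨a, ha, b, hb, rfl⟩ := Finset.mem_add.1 (support_mul p q hm)
  rw [map_add, Nat.cast_add, hp a ha, hq b hb]

end Grading

theorem mem_smul_top_of_forall_mem {R ι : Type*} [CommSemiring R] [Finite ι] {J : Ideal R}
    {v : ι → R} (hv : ∀ i, v i ∈ J) : v ∈ J • (⊤ : Submodule R (ι → R)) := by
  classical
  have := Fintype.ofFinite ι
  rw [pi_eq_sum_univ v]
  exact sum_mem fun i _ => Submodule.smul_mem_smul (hv i) trivial

theorem mem_span_X_image_of_mul_X_mem {σ K : Type*} [CommSemiring K] {s : Set σ} {z : σ}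
    (hz : z ∉ s) {g : MvPolynomial σ K} (hg : g * X z ∈ Ideal.span (X '' s)) :
    g ∈ Ideal.span (X '' s) := by
  rw [mem_ideal_span_X_image] at hg ⊢
  intro m hm
  obtain ⟨y, hy, hym⟩ := hg (m + Finsupp.single z 1) (by
    rwa [mem_support_iff, coeff_mul_X, ← mem_support_iff])
  have hyz : y ≠ z := ne_of_mem_of_not_mem hy hz
  exact ⟨y, hy, by simpa [Finsupp.single_eq_of_ne hyz] using hym⟩

/-- A finite, linearly ordered family `gen` of vectors in a free module over `K[σ]`, all homogeneous
of the same degree, with linear quotients: the colon ideal of `gen b` with respect to its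
predecessors is generated by the set `vars b` of variables. Ideals are the case of a single
coordinate; the general case is needed for their syzygies. -/
structure LinearQuotients (σ : Type) (K : Type*) [CommRing K] where
  coord : Type
  index : Type
  [fintypeIndex : Fintype index]
  [linearOrderIndex : LinearOrder index]
  gen : index → coord → MvPolynomial σ K
  degree : ℕ
  isHomogeneous_gen : ∀ b a, (gen b a).IsHomogeneous degree
  vars : index → Finset σ
  colon_gen : ∀ b, (Submodule.span (MvPolynomial σ K) (gen '' Set.Iio b)).colon {gen b} =
    Ideal.span (X '' (vars b : Set σ))

namespace LinearQuotients

attribute [instance] fintypeIndex linearOrderIndex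

section Syzygies

variable {σ : Type} {K : Type*} [CommRing K] (S : LinearQuotients σ K)

/-- The map from the free module on `S.index` that sends the standard basis to the family. -/
noncomputable def toMap : (S.index → MvPolynomial σ K) →ₗ[MvPolynomial σ K]
    (S.coord → MvPolynomial σ K) :=
  Fintype.linearCombination (MvPolynomial σ K) S.gen

theorem toMap_eq_sum (v : S.index → MvPolynomial σ K) : S.toMap v = ∑ b, v b • S.gen b :=
  Fintype.linearCombination_apply _ _ _

theorem toMap_apply (v : S.index → MvPolynomial σ K) (a : S.coord) :
    S.toMap v a = ∑ b, v b * S.gen b a := by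
  simp only [toMap_eq_sum, Finset.sum_apply, Pi.smul_apply, smul_eq_mul]

theorem toMap_homogeneousComponent (k : ℕ) (v : S.index → MvPolynomial σ K) (a : S.coord) :
    S.toMap (fun b => homogeneousComponent k (v b)) a =
      homogeneousComponent (k + S.degree) (S.toMap v a) := by
  simp only [toMap_apply, map_sum,
    homogeneousComponent_mul_of_isHomogeneous (S.isHomogeneous_gen _ a)]

theorem isHomogeneousOfDegree_toMap {v : S.index → MvPolynomial σ K} {z : ℤ}
    (hv : ∀ b, IsHomogeneousOfDegree (v b) z) (a : S.coord) :
    IsHomogeneousOfDegree (S.toMap v a) (z + S.degree) := by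
  rw [toMap_apply]
  exact .sum fun b _ => (hv b).mul (isHomogeneousOfDegree_natCast.2 (S.isHomogeneous_gen b a))

/-- The index set of the linear syzygies: an index `b` together with a variable in the colon ideal
of `S.gen b`, ordered lexicographically. -/
abbrev SyzygyIndex : Type := Σₗ b : S.index, S.vars b

theorem exists_linear_relation (p : S.SyzygyIndex) :
    ∃ c : S.index → MvPolynomial σ K, (∀ i, (c i).IsHomogeneous 1) ∧ (∀ i, p.1 ≤ i → c i = 0) ∧
      S.toMap c = (X p.2.1 : MvPolynomial σ K) • S.gen p.1 := by
  obtain ⟨b, z, hz⟩ := p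
  have hX : (X z : MvPolynomial σ K) • S.gen b ∈
      Submodule.span (MvPolynomial σ K) (S.gen '' Set.Iio b) := by
    rw [← Submodule.mem_colon_singleton, S.colon_gen]
    exact Ideal.subset_span ⟨z, hz, rfl⟩
  obtain ⟨l, hl, hlX⟩ := Finsupp.mem_span_image_iff_linearCombination _ |>.1 hX
  refine ⟨fun i => homogeneousComponent 1 (l i), fun i => homogeneousComponent_isHomogeneous _ _,
    fun i hi => ?_, ?_⟩
  · have : l i = 0 := Finsupp.notMem_support_iff.1 fun hmem => (hl hmem).not_ge hi
    simp only [this, map_zero]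
  · have hlmap : S.toMap l = (X z : MvPolynomial σ K) • S.gen b := by
      rw [← hlX, toMap_eq_sum, Finsupp.linearCombination_apply, Finsupp.sum_fintype _ _ (by simp)]
    funext a
    rw [toMap_homogeneousComponent, hlmap, Pi.smul_apply, smul_eq_mul,
      homogeneousComponent_mul_of_isHomogeneous (S.isHomogeneous_gen b a),
      homogeneousComponent_eq_self (isHomogeneous_X K z)]

theorem exists_linear_syzygy (p : S.SyzygyIndex) :
    ∃ s : S.index → MvPolynomial σ K, (∀ i, (s i).IsHomogeneous 1) ∧ s p.1 = X p.2.1 ∧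
      (∀ i, p.1 < i → s i = 0) ∧ S.toMap s = 0 := by
  obtain ⟨c, hc, hc0, hcX⟩ := S.exists_linear_relation p
  refine ⟨Pi.single p.1 (X p.2.1) - c, fun i => IsHomogeneous.sub ?_ (hc i), ?_, fun i hi => ?_, ?_⟩
  · rcases eq_or_ne i p.1 with rfl | hi
    · simpa only [Pi.single_eq_same] using isHomogeneous_X K _
    · simpa only [Pi.single_eq_of_ne hi] using isHomogeneous_zero σ K 1
  · simp [hc0 p.1 le_rfl]
  · simp [hc0 i hi.le, hi.ne']
  · rw [map_sub, hcX, sub_eq_zero]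
    exact Fintype.linearCombination_apply_single _ _ _ _

/-- The linear syzygy of `S.gen` with last entry `X z` at position `b`, for `p = (b, z)`. -/
noncomputable def syzygy (p : S.SyzygyIndex) : S.index → MvPolynomial σ K :=
  (S.exists_linear_syzygy p).choose

theorem isHomogeneous_syzygy (p : S.SyzygyIndex) (i : S.index) :
    (S.syzygy p i).IsHomogeneous 1 :=
  (S.exists_linear_syzygy p).choose_spec.1 i

theorem syzygy_apply_self (p : S.SyzygyIndex) : S.syzygy p p.1 = X p.2.1 :=
  (S.exists_linear_syzygy p).choose_spec.2.1

theorem syzygy_toLex_apply_self (b : S.index) (z : S.vars b) :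
    S.syzygy (toLex ⟨b, z⟩) b = X z.1 :=
  S.syzygy_apply_self (toLex ⟨b, z⟩)

theorem syzygy_apply_of_lt (p : S.SyzygyIndex) {i : S.index} (hi : p.1 < i) : S.syzygy p i = 0 :=
  (S.exists_linear_syzygy p).choose_spec.2.2.1 i hi

theorem toMap_syzygy (p : S.SyzygyIndex) : S.toMap (S.syzygy p) = 0 :=
  (S.exists_linear_syzygy p).choose_spec.2.2.2

theorem map_proj_span_syzygy (b : S.index) :
    (Submodule.span (MvPolynomial σ K) (S.syzygy '' {p | p.1 = b})).map
      (LinearMap.proj b : (S.index → MvPolynomial σ K) →ₗ[MvPolynomial σ K] _) =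
      Ideal.span (X '' (S.vars b : Set σ)) := by
  rw [Submodule.map_span, Set.image_image]
  congr 1
  ext g
  constructor
  · rintro ⟨p, rfl, rfl⟩
    exact ⟨p.2.1, p.2.2, (S.syzygy_apply_self p).symm⟩
  · rintro ⟨z, hz, rfl⟩
    exact ⟨toLex ⟨b, z, hz⟩, rfl, S.syzygy_toLex_apply_self b ⟨z, hz⟩⟩

theorem apply_mem_span_vars {b : S.index} {v : S.index → MvPolynomial σ K} (hv : S.toMap v = 0)
    (hvb : ∀ i, b < i → v i = 0) : v b ∈ Ideal.span (X '' (S.vars b : Set σ)) := by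
  rw [← S.colon_gen, Submodule.mem_colon_singleton]
  rw [toMap_eq_sum, ← Finset.add_sum_erase _ _ (Finset.mem_univ b)] at hv
  rw [eq_neg_of_add_eq_zero_left hv]
  refine neg_mem (sum_mem fun i hi => ?_)
  rcases lt_or_gt_of_ne (Finset.ne_of_mem_erase hi) with hib | hbi
  · exact Submodule.smul_mem _ _ (Submodule.subset_span ⟨i, hib, rfl⟩)
  · rw [hvb i hbi, zero_smul]
    exact zero_mem _

/-- A Gröbner-type division: the last nonzero entry of a syzygy is cancelled by linear syzygies. -/
theorem mem_span_syzygy {s : Finset S.index} (hs : IsLowerSet (s : Set S.index))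
    {v : S.index → MvPolynomial σ K} (hv : S.toMap v = 0) (hvs : ∀ i ∉ s, v i = 0) :
    v ∈ Submodule.span (MvPolynomial σ K) (S.syzygy '' {p | p.1 ∈ s}) := by
  induction s using Finset.induction_on_max generalizing v with
  | empty =>
    rw [funext fun i => hvs i (Finset.notMem_empty i)]
    exact zero_mem _
  | insert b s hsb ih =>
    have mem_of_le {i : S.index} (hi : i ≤ b) : i ∈ insert b s :=
      hs hi (Finset.mem_insert_self b s)
    have notMem_of_lt {i : S.index} (hi : b < i) : i ∉ insert b s := fun h =>
      (Finset.mem_insert.1 h).elim hi.ne' fun h => (hsb i h).not_gt hi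
    obtain ⟨t, ht, htb : t b = v b⟩ := (S.map_proj_span_syzygy b).ge
      (S.apply_mem_span_vars hv fun i hi => hvs i (notMem_of_lt hi))
    have ht0 : S.toMap t = 0 := by
      refine (Submodule.span_le (p := LinearMap.ker S.toMap)).2 ?_ ht
      rintro _ ⟨p, -, rfl⟩
      exact S.toMap_syzygy p
    have htlt (i : S.index) (hi : b < i) : t i = 0 := by
      refine (Submodule.span_le (p := LinearMap.ker (LinearMap.proj i))).2 ?_ ht
      rintro _ ⟨p, rfl, rfl⟩
      exact S.syzygy_apply_of_lt p hi
    have hs' : IsLowerSet (s : Set S.index) := fun i j hji hi =>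
      Finset.mem_of_mem_insert_of_ne (mem_of_le (hji.trans (hsb i hi).le))
        (hji.trans_lt (hsb i hi)).ne
    have hsub : v - t ∈ Submodule.span (MvPolynomial σ K) (S.syzygy '' {p | p.1 ∈ s}) := by
      refine ih hs' (by rw [map_sub, hv, ht0, sub_zero]) fun i hi => ?_
      rcases lt_trichotomy i b with hib | rfl | hbi
      · exact absurd (Finset.mem_of_mem_insert_of_ne (mem_of_le hib.le) hib.ne) hi
      · rw [Pi.sub_apply, htb, sub_self]
      · rw [Pi.sub_apply, hvs i (notMem_of_lt hbi), htlt i hbi, sub_zero]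
    rw [← sub_add_cancel v t]
    refine add_mem (Submodule.span_mono (Set.image_mono fun p hp => ?_) hsub)
      (Submodule.span_mono (Set.image_mono fun p hp => ?_) ht)
    · exact Finset.mem_insert_of_mem hp
    · exact mem_of_le (le_of_eq hp)

theorem ker_toMap :
    LinearMap.ker S.toMap = Submodule.span (MvPolynomial σ K) (Set.range S.syzygy) := by
  apply le_antisymm
  · intro v hv
    exact Submodule.span_mono (Set.image_subset_range _ _) (S.mem_span_syzygy (s := Finset.univ)
      (by simpa using isLowerSet_univ) hv fun i hi => absurd (Finset.mem_univ i) hi)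
  · rw [Submodule.span_le]
    rintro _ ⟨p, rfl⟩
    exact S.toMap_syzygy p

variable [LinearOrder σ]

theorem span_syzygy_Iio_le_comap_proj (p : S.SyzygyIndex) :
    Submodule.span (MvPolynomial σ K) (S.syzygy '' Set.Iio p) ≤
      Submodule.comap (LinearMap.proj p.1)
        (Ideal.span (X '' (({z ∈ S.vars p.1 | z < p.2.1} : Finset σ) : Set σ))) := by
  rw [Submodule.span_le]
  rintro _ ⟨q, hqp, rfl⟩
  change S.syzygy q p.1 ∈ Ideal.span _
  obtain ⟨b, z⟩ := p
  obtain ⟨c, y⟩ := q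
  rcases Sigma.Lex.lt_def.1 hqp with hcb | ⟨hcb, hyz⟩
  · rw [S.syzygy_apply_of_lt _ hcb]
    exact zero_mem _
  · dsimp only at hcb hyz
    subst hcb
    exact Ideal.subset_span ⟨y, Finset.mem_coe.2 (Finset.mem_filter.2 ⟨y.2, hyz⟩),
      (S.syzygy_toLex_apply_self c y).symm⟩

/-- The Koszul-type relation: `X y` times the syzygy of `(b, z)` minus `X z` times that of `(b, y)`
vanishes at all positions from `b` on. -/
theorem X_smul_syzygy_mem_span_Iio (b : S.index) {y z : S.vars b} (hyz : y < z) :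
    (X y.1 : MvPolynomial σ K) • S.syzygy (toLex ⟨b, z⟩) ∈
      Submodule.span (MvPolynomial σ K) (S.syzygy '' Set.Iio (toLex ⟨b, z⟩)) := by
  set koszul := (X y.1 : MvPolynomial σ K) • S.syzygy (toLex ⟨b, z⟩) -
    (X z.1 : MvPolynomial σ K) • S.syzygy (toLex ⟨b, y⟩) with hkoszul
  have hker : S.toMap koszul = 0 := by
    rw [hkoszul, map_sub, map_smul, map_smul, toMap_syzygy, toMap_syzygy, smul_zero, smul_zero,
      sub_zero]
  have hvanish (i : S.index) (hi : b ≤ i) : koszul i = 0 := by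
    rw [hkoszul, Pi.sub_apply, Pi.smul_apply, Pi.smul_apply, smul_eq_mul, smul_eq_mul]
    rcases hi.eq_or_lt with rfl | hi
    · rw [syzygy_toLex_apply_self, syzygy_toLex_apply_self, mul_comm, sub_self]
    · rw [S.syzygy_apply_of_lt (toLex ⟨b, z⟩) hi, S.syzygy_apply_of_lt (toLex ⟨b, y⟩) hi, mul_zero,
        mul_zero, sub_zero]
  have hspan : koszul ∈ Submodule.span (MvPolynomial σ K) (S.syzygy '' Set.Iio (toLex ⟨b, z⟩)) := by
    refine Submodule.span_mono (Set.image_mono fun p hp => ?_) (S.mem_span_syzygy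
      (s := (Set.Iio b).toFinset) (by simpa only [Set.coe_toFinset] using isLowerSet_Iio b) hker
      fun i hi => hvanish i (by simpa using hi))
    have hpb : p.1 < b := by simpa using hp
    exact Sigma.Lex.lt_def.2 (Or.inl hpb)
  rw [← sub_add_cancel ((X y.1 : MvPolynomial σ K) • S.syzygy (toLex ⟨b, z⟩))]
  exact add_mem hspan (Submodule.smul_mem _ _ (Submodule.subset_span
    ⟨toLex ⟨b, y⟩, Sigma.Lex.lt_def.2 (Or.inr ⟨rfl, hyz⟩), rfl⟩))

theorem colon_syzygy (p : S.SyzygyIndex) :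
    (Submodule.span (MvPolynomial σ K) (S.syzygy '' Set.Iio p)).colon {S.syzygy p} =
      Ideal.span (X '' (({z ∈ S.vars p.1 | z < p.2.1} : Finset σ) : Set σ)) := by
  apply le_antisymm
  · intro g hg
    have hgX := S.span_syzygy_Iio_le_comap_proj p (Submodule.mem_colon_singleton.1 hg)
    rw [Submodule.mem_comap, map_smul, LinearMap.proj_apply, syzygy_apply_self] at hgX
    exact mem_span_X_image_of_mul_X_mem (by simp) hgX
  · rw [Ideal.span_le]
    rintro _ ⟨y, hy, rfl⟩
    obtain ⟨hy, hyz⟩ := Finset.mem_filter.1 (Finset.mem_coe.1 hy)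
    exact Submodule.mem_colon_singleton.2
      (S.X_smul_syzygy_mem_span_Iio p.1 (y := ⟨y, hy⟩) (z := p.2) hyz)

/-- The family of linear syzygies of a family with linear quotients. -/
noncomputable def next : LinearQuotients σ K where
  coord := S.index
  index := S.SyzygyIndex
  gen := S.syzygy
  degree := 1
  isHomogeneous_gen := S.isHomogeneous_syzygy
  vars p := {z ∈ S.vars p.1 | z < p.2.1}
  colon_gen := S.colon_syzygy

/-- The `i`-th iterated family of linear syzygies; its indices label the basis of the `i`-th module
of the resolution. -/
noncomputable def iter : ℕ → LinearQuotients σ K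
  | 0 => S
  | i + 1 => (iter i).next

/-- The differential onto the syzygy module. It is `S.next.toMap`, with the codomain spelled as the
domain of `S.toMap`. -/
noncomputable def syzygyMap : (S.next.index → MvPolynomial σ K) →ₗ[MvPolynomial σ K]
    (S.index → MvPolynomial σ K) :=
  S.next.toMap

theorem exact_syzygyMap_toMap : Function.Exact S.syzygyMap S.toMap := by
  rw [LinearMap.exact_iff, ker_toMap]
  exact (Fintype.range_linearCombination _ _).symm

theorem range_syzygyMap_le : LinearMap.range S.syzygyMap ≤
    idealOfVars σ K • (⊤ : Submodule (MvPolynomial σ K) (S.index → MvPolynomial σ K)) := by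
  rintro _ ⟨v, rfl⟩
  refine mem_smul_top_of_forall_mem fun a => ?_
  have hsum : S.syzygyMap v a = ∑ p, v p * S.syzygy p a := S.next.toMap_apply v a
  rw [hsum]
  refine sum_mem fun p _ => Ideal.mul_mem_left _ _ ?_
  simpa only [pow_one] using mem_pow_idealOfVars_of_isHomogeneous (S.isHomogeneous_syzygy p a)

end Syzygies

section Augmentation

variable {σ : Type} {K : Type*} [CommRing K] (S : LinearQuotients σ K) [Unique S.coord]

/-- The ideal generated by a family of vectors of length one. -/
noncomputable def ideal : Ideal (MvPolynomial σ K) :=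
  Ideal.span (Set.range fun b => S.gen b default)

theorem toMap_apply_mem_ideal (v : S.index → MvPolynomial σ K) : S.toMap v default ∈ S.ideal := by
  rw [toMap_apply]
  exact sum_mem fun b _ => Ideal.mul_mem_left _ _ (Ideal.subset_span ⟨b, rfl⟩)

/-- The augmentation of the resolution of `S.ideal`. -/
noncomputable def augmentation :
    (S.index → MvPolynomial σ K) →ₗ[MvPolynomial σ K] S.ideal :=
  (LinearMap.proj default ∘ₗ S.toMap).codRestrict S.ideal S.toMap_apply_mem_ideal

theorem coe_augmentation (v : S.index → MvPolynomial σ K) :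
    (S.augmentation v : MvPolynomial σ K) = S.toMap v default :=
  rfl

theorem augmentation_surjective : Function.Surjective S.augmentation := by
  rintro ⟨f, hf⟩
  obtain ⟨v, rfl⟩ := Ideal.mem_span_range_iff_exists_fun.1 hf
  exact ⟨v, Subtype.ext (S.toMap_apply v default)⟩

theorem exact_syzygyMap_augmentation [LinearOrder σ] :
    Function.Exact S.syzygyMap S.augmentation := fun v => by
  rw [← S.exact_syzygyMap_toMap v, ← Submodule.coe_eq_zero, coe_augmentation, funext_iff,
    Unique.forall_iff, Pi.zero_apply]

end Augmentation

section Resolution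

variable {σ : Type} {K : Type*} [Field K] (S : LinearQuotients σ K) [Unique S.coord]

/-- The resolution of `S.ideal` by the iterated families of linear syzygies. -/
noncomputable def resolution [LinearOrder σ] : MinimalGradedFreeResolution S.ideal where
  basis i := (S.iter i).index
  shift i _ := i + S.degree
  d i := (S.iter i).syzygyMap
  ε := S.augmentation
  ε_surjective := S.augmentation_surjective
  exact_zero := S.exact_syzygyMap_augmentation
  exact_succ i := (S.iter i).next.exact_syzygyMap_toMap
  ε_graded v k hv := by
    have h := S.isHomogeneousOfDegree_toMap hv default
    rwa [Nat.cast_zero, zero_add, sub_add_cancel] at h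
  d_graded i v k hv a := by
    have h := (S.iter i).next.isHomogeneousOfDegree_toMap hv a
    have hdeg : k - (((i + 1 : ℕ) : ℤ) + S.degree) + (1 : ℕ) = k - (i + S.degree) := by
      push_cast
      ring
    exact hdeg ▸ h
  minimal i := (S.iter i).range_syzygyMap_le

theorem hasLinearResolution : HasLinearResolution S.ideal S.degree := by
  obtain ⟨_, -⟩ := exists_wellFoundedLT σ
  refine ⟨S.resolution, fun i j hj => ?_⟩
  have : IsEmpty {b : S.resolution.basis i // S.resolution.shift i b = j} :=
    ⟨fun b => hj b.2.symm⟩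
  exact Nat.card_of_isEmpty

end Resolution

end LinearQuotients

theorem const_mem_span_image_const_iff {R ι : Type*} [CommSemiring R] [Nonempty ι] {s : Set R}
    {x : R} :
    Function.const ι x ∈ Submodule.span R (Function.const ι '' s) ↔ x ∈ Ideal.span s :=
  Submodule.apply_mem_span_image_iff_mem_span (f := LinearMap.pi fun _ : ι => LinearMap.id)
    Function.const_injective

theorem hasLinearResolution_of_colon {σ : Type} {K : Type*} [Field K] {B : Type} [Finite B]
    [LinearOrder B] {d : ℕ} {w : B → MvPolynomial σ K} (hw : ∀ b, (w b).IsHomogeneous d)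
    (Z : B → Finset σ)
    (hZ : ∀ b, (Ideal.span (w '' Set.Iio b)).colon {w b} = Ideal.span (X '' (Z b : Set σ))) :
    HasLinearResolution (Ideal.span (Set.range w)) d := by
  have := Fintype.ofFinite B
  let S : LinearQuotients σ K :=
    { coord := Unit
      index := B
      gen := fun b => Function.const Unit (w b)
      degree := d
      isHomogeneous_gen := fun b _ => hw b
      vars := Z
      colon_gen := fun b => by
        rw [← hZ, ← Function.comp_def (Function.const Unit) w, Set.image_comp]
        ext g
        rw [Submodule.mem_colon_singleton, Submodule.mem_colon_singleton]
        exact const_mem_span_image_const_iff (s := w '' Set.Iio b) (x := g * w b) }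
  have : Unique S.coord := inferInstanceAs (Unique Unit)
  exact S.hasLinearResolution

section Monomials

theorem colon_span_monomial_image {σ K : Type*} [CommSemiring K] {A : Set (σ →₀ ℕ)} {b : σ →₀ ℕ}
    {Z : Set σ} (hZ : ∀ a ∈ A, ∃ z ∈ Z, b z < a z)
    (hA : ∀ z ∈ Z, ∃ c ∈ A, c ≤ b + Finsupp.single z 1) :
    (Ideal.span ((fun a => monomial a (1 : K)) '' A)).colon {monomial b 1} =
      Ideal.span (X '' Z) := by
  apply le_antisymm
  · intro g hg
    rw [Submodule.mem_colon_singleton, smul_eq_mul, mem_ideal_span_monomial_image] at hg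
    rw [mem_ideal_span_X_image]
    intro m hm
    obtain ⟨a, ha, ham⟩ := hg (m + b) (by
      rwa [mem_support_iff, coeff_mul_monomial, mul_one, ← mem_support_iff])
    obtain ⟨z, hz, hba⟩ := hZ a ha
    have hamz : a z ≤ m z + b z := ham z
    exact ⟨z, hz, by omega⟩
  · rw [Ideal.span_le]
    rintro _ ⟨z, hz, rfl⟩
    obtain ⟨c, hc, hcb⟩ := hA z hz
    have hX : X z * monomial b (1 : K) = monomial (b + Finsupp.single z 1) 1 := by
      rw [X, monomial_mul, one_mul, add_comm]
    rw [SetLike.mem_coe, Submodule.mem_colon_singleton, smul_eq_mul, hX,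
      mem_ideal_span_monomial_image]
    intro m hm
    exact ⟨c, hc, hcb.trans_eq (Finset.mem_singleton.1 (support_monomial_subset hm)).symm⟩

theorem hasLinearResolution_of_monomial_family {σ : Type} (K : Type*) [Field K] {B : Type}
    [Finite B] [LinearOrder B] {d : ℕ} {w : B → σ →₀ ℕ} (hw : ∀ b, (w b).degree = d)
    (hquot : ∀ b, ∀ a < b, ∃ z, w b z < w a z ∧ ∃ c < b, w c ≤ w b + Finsupp.single z 1) :
    HasLinearResolution (Ideal.span (Set.range fun b => monomial (w b) (1 : K))) d := by
  classical
  have := Fintype.ofFinite B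
  choose z hz hc using hquot
  refine hasLinearResolution_of_colon (fun b => isHomogeneous_monomial _ (hw b))
    (fun b => Finset.univ.image fun a : Set.Iio b => z b a a.2) fun b => ?_
  rw [← Set.image_image (fun a => monomial a (1 : K)) w]
  apply colon_span_monomial_image
  · rintro _ ⟨a, hab, rfl⟩
    exact ⟨z b a hab, by simpa using ⟨a, hab, rfl⟩, hz b a hab⟩
  · intro y hy
    obtain ⟨a, hab, rfl⟩ : ∃ a, ∃ hab : a < b, z b a hab = y := by simpa using hy
    obtain ⟨c, hcb, hle⟩ := hc b a hab
    exact ⟨w c, ⟨c, hcb, rfl⟩, hle⟩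

/-- Ties of the key function may be broken arbitrarily, since the exponent vector `a` itself is
allowed as a witness even if it has the same key as `b`. -/
theorem hasLinearResolution_of_key {σ : Type} (K : Type*) [Field K] {L : Type*} [LinearOrder L]
    {s : Set (σ →₀ ℕ)} (hs : s.Finite) {d : ℕ} (hd : ∀ a ∈ s, a.degree = d) (κ : (σ →₀ ℕ) → L)
    (hquot : ∀ b ∈ s, ∀ a ∈ s, a ≠ b → κ a ≤ κ b →
      ∃ z, b z < a z ∧ ∃ c ∈ s, (c = a ∨ κ c < κ b) ∧ c ≤ b + Finsupp.single z 1) :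
    HasLinearResolution (Ideal.span ((fun a => monomial a (1 : K)) '' s)) d := by
  have := hs.to_subtype
  let key (a : s) : L ×ₗ Fin (Nat.card s) := toLex (κ a, Finite.equivFin s a)
  have hkey : Function.Injective key := fun a b hab =>
    (Finite.equivFin s).injective (congrArg (fun p => (ofLex p).2) hab)
  let _ : LinearOrder s := LinearOrder.lift' key hkey
  rw [Set.image_eq_range]
  refine hasLinearResolution_of_monomial_family K (w := Subtype.val) (fun a => hd a a.2)
    fun b a hab => ?_
  have hlt : key a < key b := hab
  obtain ⟨z, hz, c, hcs, hc, hle⟩ := hquot b b.2 a a.2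
    (fun h => hlt.ne (congrArg key (Subtype.ext h))) (Prod.Lex.monotone_fst _ _ hlt.le)
  refine ⟨z, hz, ⟨c, hcs⟩, ?_, hle⟩
  rcases hc with rfl | hc
  · exact hab
  · exact Prod.Lex.toLex_lt_toLex.2 (Or.inl hc)

end Monomials

section Exponents

variable {ι : Type*}

theorem exists_apply_lt_of_degree_le {a b : ι →₀ ℕ} (hd : b.degree ≤ a.degree) (hne : a ≠ b) :
    ∃ i, b i < a i := by
  by_contra! hab
  obtain ⟨c, rfl⟩ := exists_add_of_le (show a ≤ b from hab)
  rw [map_add, add_le_iff_nonpos_right, nonpos_iff_eq_zero, Finsupp.degree_eq_zero_iff] at hd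
  exact hne (by rw [hd, add_zero])

theorem degree_sub_single_add_one {a : ι →₀ ℕ} {i : ι} (hi : a i ≠ 0) :
    (a - Finsupp.single i 1).degree + 1 = a.degree := by
  conv_rhs => rw [← tsub_add_cancel_of_le (Finsupp.single_le_iff.2 (Nat.one_le_iff_ne_zero.2 hi)),
    map_add, Finsupp.degree_single]

theorem add_single_le {v : ι → ℕ} {a b : ι →₀ ℕ} {i : ι} (ha : ⇑a ≤ v) (hb : ⇑b ≤ v)
    (hi : b i < a i) : ⇑(b + Finsupp.single i 1 : ι →₀ ℕ) ≤ v := by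
  intro j
  rw [Finsupp.add_apply]
  rcases eq_or_ne j i with rfl | hj
  · rw [Finsupp.single_eq_same]
    exact hi.trans_le (ha j)
  · rw [Finsupp.single_eq_of_ne hj]
    exact hb j

theorem exists_lex_exchange [LinearOrder ι] {a b : ι →₀ ℕ} (hd : a.degree ≤ b.degree)
    (hlt : toLex b < toLex a) :
    ∃ i, b i < a i ∧ ∃ c : ι →₀ ℕ, c.degree = b.degree ∧ toLex b < toLex c ∧
      c ≤ b + Finsupp.single i 1 := by
  obtain ⟨i, heq, hi⟩ := Finsupp.Lex.lt_iff.1 hlt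
  obtain ⟨j, hj⟩ := exists_apply_lt_of_degree_le hd fun h => hlt.ne (congrArg toLex h)
  have hij : i < j := by
    by_contra! hji
    rcases hji.eq_or_lt with rfl | hji
    · exact hi.not_gt hj
    · exact (heq j hji).not_gt hj
  have hbj : (b + Finsupp.single i 1 : ι →₀ ℕ) j ≠ 0 := by
    rw [Finsupp.add_apply, Finsupp.single_eq_of_ne hij.ne', add_zero]
    exact (Nat.zero_le _).trans_lt hj |>.ne'
  set c := b + Finsupp.single i 1 - Finsupp.single j 1
  have hadd : c + Finsupp.single j 1 = b + Finsupp.single i 1 :=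
    tsub_add_cancel_of_le (Finsupp.single_le_iff.2 (Nat.one_le_iff_ne_zero.2 hbj))
  refine ⟨i, hi, c, ?_, ?_, tsub_le_self⟩
  · have := degree_sub_single_add_one hbj
    rwa [map_add, Finsupp.degree_single, add_left_inj] at this
  · refine lt_of_add_lt_add_right (a := toLex (Finsupp.single j 1)) ?_
    rw [← toLex_add, ← toLex_add, hadd, toLex_add, toLex_add]
    gcongr
    exact Finsupp.Lex.single_lt_iff.2 hij

end Exponents

section Linearization

variable {ι G : Type*}

theorem degree_sumElim (a : ι →₀ ℕ) (b : G →₀ ℕ) :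
    (a.sumElim b).degree = a.degree + b.degree := by
  rw [Finsupp.sumElim_eq_add, map_add, Finsupp.degree_mapDomain, Finsupp.degree_mapDomain]

theorem sumElim_mono {a a' : ι →₀ ℕ} {b b' : G →₀ ℕ} (ha : a ≤ a') (hb : b ≤ b') :
    a.sumElim b ≤ a'.sumElim b' :=
  Sum.forall.2 ⟨ha, hb⟩

/-- The exponent vector of the part of a monomial in the `x`-variables. -/
noncomputable def xPart (u : ι ⊕ G →₀ ℕ) : ι →₀ ℕ :=
  u.comapDomain Sum.inl Sum.inl_injective.injOn

theorem xPart_sumElim (a : ι →₀ ℕ) (b : G →₀ ℕ) : xPart (a.sumElim b) = a :=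
  Finsupp.comapDomain_inl_sumElim a b

theorem eq_sumElim_zero_of_degree_le {u : ι ⊕ G →₀ ℕ} (hu : u.degree ≤ (xPart u).degree) :
    u = (xPart u).sumElim 0 := by
  have hy : (u.comapDomain Sum.inr Sum.inr_injective.injOn).degree = 0 := by
    have h := degree_sumElim (xPart u) (u.comapDomain Sum.inr Sum.inr_injective.injOn)
    rw [xPart, Finsupp.comapDomain_sumElim_comapDomain, ← xPart] at h
    omega
  rw [← (Finsupp.degree_eq_zero_iff _).1 hy]
  exact (Finsupp.comapDomain_sumElim_comapDomain u).symm

/-- The exponent vectors of the generators of a linearization: those of the monomials `x ^ a` of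
degree `d` with `a ≤ v`, and those of the monomials `(f g / x_k) y_g`. -/
def linearizationExponents (d : ℕ) (v : ι → ℕ) (f : G → ι →₀ ℕ) : Set (ι ⊕ G →₀ ℕ) :=
  {u | ∃ a : ι →₀ ℕ, a.degree = d ∧ ⇑a ≤ v ∧ u = a.sumElim 0} ∪
    {u | ∃ g k, f g k ≠ 0 ∧ u = (f g - Finsupp.single k 1).sumElim (Finsupp.single g 1)}

variable {d : ℕ} {v : ι → ℕ} {f : G → ι →₀ ℕ}

theorem degree_of_mem_linearizationExponents (hd : ∀ g, (f g).degree = d) {u : ι ⊕ G →₀ ℕ}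
    (hu : u ∈ linearizationExponents d v f) : u.degree = d := by
  rcases hu with ⟨a, ha, -, rfl⟩ | ⟨g, k, hk, rfl⟩
  · rw [degree_sumElim, ha, map_zero, add_zero]
  · rw [degree_sumElim, Finsupp.degree_single, degree_sub_single_add_one hk, hd]

theorem xPart_le_of_mem_linearizationExponents (hv : ∀ g, ⇑(f g) ≤ v) {u : ι ⊕ G →₀ ℕ}
    (hu : u ∈ linearizationExponents d v f) : ⇑(xPart u) ≤ v := by
  rcases hu with ⟨a, -, ha, rfl⟩ | ⟨g, k, -, rfl⟩
  · rwa [xPart_sumElim]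
  · rw [xPart_sumElim]
    exact fun i => (Nat.sub_le _ _).trans (hv g i)

/-- The key by which the generators are sorted: lexicographically larger `x`-parts come first. -/
noncomputable def xKey (u : ι ⊕ G →₀ ℕ) : (Lex (ι →₀ ℕ))ᵒᵈ :=
  OrderDual.toDual (toLex (xPart u))

theorem finite_linearizationExponents [Finite ι] [Finite G] (hd : ∀ g, (f g).degree = d) :
    (linearizationExponents d v f).Finite :=
  (Finsupp.finite_of_degree_le d).subset fun _ hu =>
    (degree_of_mem_linearizationExponents hd hu).le

theorem exists_eq_sumElim_single_of_xPart_le (hd : ∀ g, (f g).degree = d) {a : ι ⊕ G →₀ ℕ}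
    {h : ι →₀ ℕ} (ha : a ∈ linearizationExponents d v f) (hhd : h.degree + 1 = d)
    (hle : xPart a ≤ h) : ∃ g, a = h.sumElim (Finsupp.single g 1) := by
  rcases ha with ⟨a, had, -, rfl⟩ | ⟨g, k, hk, rfl⟩
  · rw [xPart_sumElim] at hle
    have := Finsupp.degree_mono hle
    omega
  · rw [xPart_sumElim] at hle
    refine ⟨g, congrArg (Finsupp.sumElim · _) ?_⟩
    by_contra hne
    have hdeg : h.degree ≤ (f g - Finsupp.single k 1).degree := by
      have := degree_sub_single_add_one hk
      rw [hd] at this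
      omega
    obtain ⟨i, hi⟩ := exists_apply_lt_of_degree_le hdeg hne
    exact (hle i).not_gt hi

variable [LinearOrder ι]

theorem exists_quotient_of_sumElim_zero (hd : ∀ g, (f g).degree = d) (hv : ∀ g, ⇑(f g) ≤ v)
    {a : ι ⊕ G →₀ ℕ} {b : ι →₀ ℕ} (ha : a ∈ linearizationExponents d v f) (hbd : b.degree = d)
    (hbv : ⇑b ≤ v) (hne : a ≠ b.sumElim 0) (hle : xKey a ≤ xKey (b.sumElim (0 : G →₀ ℕ))) :
    ∃ z, b.sumElim 0 z < a z ∧ ∃ c ∈ linearizationExponents d v f,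
      xKey c < xKey (b.sumElim (0 : G →₀ ℕ)) ∧ c ≤ b.sumElim 0 + Finsupp.single z 1 := by
  have hda : a.degree = d := degree_of_mem_linearizationExponents hd ha
  have hxd : (xPart a).degree ≤ b.degree := by
    rw [hbd, ← hda]
    exact Finsupp.degree_comapDomain_le_of_canonicallyOrderedAdd _
  have hxne : xPart a ≠ b := by
    rintro rfl
    exact hne (eq_sumElim_zero_of_degree_le (hda.trans hbd.symm).le)
  have hlt : toLex b < toLex (xPart a) := by
    refine lt_of_le_of_ne ?_ fun h => hxne (toLex_inj.1 h.symm)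
    rwa [xKey, xKey, OrderDual.toDual_le_toDual, xPart_sumElim] at hle
  obtain ⟨i, hi, c, hcd, hbc, hcb⟩ := exists_lex_exchange hxd hlt
  have hcv : ⇑c ≤ v :=
    le_trans hcb (add_single_le (xPart_le_of_mem_linearizationExponents hv ha) hbv hi)
  refine ⟨Sum.inl i, hi, c.sumElim 0, Or.inl ⟨c, hcd.trans hbd, hcv, rfl⟩, ?_, ?_⟩
  · rwa [xKey, xKey, OrderDual.toDual_lt_toDual, xPart_sumElim, xPart_sumElim]
  · rw [← Finsupp.sumElim_single_zero, ← Finsupp.sumElim_add]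
    exact sumElim_mono hcb zero_le

theorem exists_quotient_of_sumElim_single (hd : ∀ g, (f g).degree = d) (hv : ∀ g, ⇑(f g) ≤ v)
    {a : ι ⊕ G →₀ ℕ} {h : ι →₀ ℕ} {g : G} (ha : a ∈ linearizationExponents d v f)
    (hhd : h.degree + 1 = d) (hhv : ⇑h ≤ v) (hne : a ≠ h.sumElim (Finsupp.single g 1)) :
    ∃ z, h.sumElim (Finsupp.single g 1) z < a z ∧ ∃ c ∈ linearizationExponents d v f,
      (c = a ∨ xKey c < xKey (h.sumElim (Finsupp.single g 1))) ∧
        c ≤ h.sumElim (Finsupp.single g 1) + Finsupp.single z 1 := by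
  by_cases hle : xPart a ≤ h
  · obtain ⟨g', rfl⟩ := exists_eq_sumElim_single_of_xPart_le hd ha hhd hle
    have hg : g' ≠ g := fun hg => hne (by rw [hg])
    refine ⟨Sum.inr g', ?_, _, ha, Or.inl rfl, ?_⟩
    · rw [Finsupp.sumElim_inr, Finsupp.sumElim_inr, Finsupp.single_eq_of_ne hg,
        Finsupp.single_eq_same]
      exact one_pos
    · rw [← Finsupp.sumElim_zero_single, ← Finsupp.sumElim_add, add_zero]
      exact sumElim_mono le_rfl le_add_self
  · obtain ⟨i, hi⟩ : ∃ i, h i < xPart a i := by simpa [Finsupp.le_def] using hle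
    refine ⟨Sum.inl i, hi, (h + Finsupp.single i 1).sumElim 0, Or.inl ⟨_, ?_,
      add_single_le (xPart_le_of_mem_linearizationExponents hv ha) hhv hi, rfl⟩, Or.inr ?_, ?_⟩
    · rw [map_add, Finsupp.degree_single, hhd]
    · rw [xKey, xKey, OrderDual.toDual_lt_toDual, xPart_sumElim, xPart_sumElim]
      refine Finsupp.toLex_monotone.strictMono_of_injective toLex.injective
        (lt_add_of_pos_right h (pos_iff_ne_zero.2 ?_))
      exact Finsupp.single_ne_zero.2 one_ne_zero
    · rw [← Finsupp.sumElim_single_zero, ← Finsupp.sumElim_add, add_zero]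
      exact sumElim_mono le_rfl zero_le

theorem hasLinearResolution_linearization {ι G : Type} [Finite ι] [LinearOrder ι] [Finite G]
    (K : Type*) [Field K] {d : ℕ} {v : ι → ℕ} {f : G → ι →₀ ℕ} (hd : ∀ g, (f g).degree = d)
    (hv : ∀ g, ⇑(f g) ≤ v) :
    HasLinearResolution
      (Ideal.span ((fun u => monomial u (1 : K)) '' linearizationExponents d v f)) d := by
  refine hasLinearResolution_of_key K (finite_linearizationExponents hd)
    (fun _ => degree_of_mem_linearizationExponents hd) xKey ?_
  rintro _ (⟨b, hbd, hbv, rfl⟩ | ⟨g, k, hk, rfl⟩) a ha hne hle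
  · obtain ⟨z, hz, c, hc, hκ, hcz⟩ := exists_quotient_of_sumElim_zero hd hv ha hbd hbv hne hle
    exact ⟨z, hz, c, hc, Or.inr hκ, hcz⟩
  · exact exists_quotient_of_sumElim_single hd hv ha
      ((degree_sub_single_add_one hk).trans (hd g)) (fun i => (Nat.sub_le _ _).trans (hv g i)) hne

end Linearization

section MonomialIdeal

variable {K : Type*} [Field K] {n : ℕ} (I : Ideal (MvPolynomial (Fin n) K)) (d : ℕ)

theorem completePart_sup_lastPart_eq_span (v : Fin n → ℕ) :
    completePart I d v ⊔ lastPart I = Ideal.span ((fun u => monomial u (1 : K)) ''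
      linearizationExponents d v (Subtype.val : minGens I → Fin n →₀ ℕ)) := by
  have hinl (a : Fin n →₀ ℕ) : rename Sum.inl (monomial a (1 : K)) =
      monomial (a.sumElim (0 : minGens I →₀ ℕ)) 1 := by
    rw [rename_monomial, Finsupp.sumElim_eq_add, Finsupp.mapDomain_zero, add_zero]
  have hinr (a : Fin n →₀ ℕ) (g : minGens I) :
      rename Sum.inl (monomial a (1 : K)) * X (Sum.inr g) =
        monomial (a.sumElim (Finsupp.single g 1)) 1 := by
    rw [rename_monomial, X, monomial_mul, one_mul, Finsupp.sumElim_eq_add,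
      Finsupp.mapDomain_single]
  rw [completePart, lastPart, ← Ideal.span_union, linearizationExponents, Set.image_union]
  congr 2
  · ext p
    constructor
    · rintro ⟨a, ha, hav, rfl⟩
      exact ⟨_, ⟨a, ha, hav, rfl⟩, (hinl a).symm⟩
    · rintro ⟨_, ⟨a, ha, hav, rfl⟩, rfl⟩
      exact ⟨a, ha, hav, (hinl a).symm⟩
  · ext p
    constructor
    · rintro ⟨g, k, hk, rfl⟩
      exact ⟨_, ⟨g, k, hk, rfl⟩, (hinr _ g).symm⟩
    · rintro ⟨_, ⟨g, k, hk, rfl⟩, rfl⟩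
      exact ⟨g, k, hk, (hinr _ g).symm⟩

theorem maxExp_le_maxExpAll (i : Fin n) : maxExp I i ≤ maxExpAll I :=
  le_ciSup (Set.finite_range _).bddAbove i

variable {I d}

theorem finite_minGens (hI : IsEquigenerated I d) : (minGens I).Finite :=
  (Finsupp.finite_of_degree_le d).subset fun f hf => (hI f hf).le

theorem le_maxExp (hI : IsEquigenerated I d) (f : minGens I) (i : Fin n) :
    f.1 i ≤ maxExp I i := by
  have := (finite_minGens hI).to_subtype
  exact le_ciSup (f := fun g : minGens I => g.1 i) (Set.finite_range _).bddAbove f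

theorem corollary3p4_general (hI : IsEquigenerated I d) {v : Fin n → ℕ}
    (hv : ∀ i, maxExp I i ≤ v i) : HasLinearResolution (completePart I d v ⊔ lastPart I) d := by
  have := (finite_minGens hI).to_subtype
  rw [completePart_sup_lastPart_eq_span]
  exact hasLinearResolution_linearization K (fun f => hI f.1 f.2)
    fun f i => (le_maxExp hI f i).trans (hv i)

end MonomialIdeal

theorem corollary3p4 {K : Type*} [Field K] {n : ℕ} (I : Ideal (MvPolynomial (Fin n) K)) (d : ℕ)
    (hmon : IsMonomialIdeal I) (hI : IsEquigenerated I d) :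
    HasLinearResolution (Lin I d) d ∧ HasLinearResolution (LINStar I d) d :=
  ⟨corollary3p4_general hI fun _ => le_rfl, corollary3p4_general hI (maxExp_le_maxExpAll I)⟩
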